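/- Let $\omega=e^{2\pi i/3}$, $\Lambda=\omega\mathbb Z\oplus\mathbb Z\subset\mathbb C$, $\Lambda^*=\frac{4\pi i}{\sqrt3}\Lambda$ and $\langle z,w\rangle=\operatorname{Re}(z\bar w)$. Let $K\in\mathbb C$ satisfy $\omega K-K\in\Lambda^*$ and $K\notin\Lambda^*$ (for instance $K=\tfrac43\pi$), and let $U:\mathbb C\to\mathbb C$ be a real analytic function on $\mathbb C=\mathbb R^2$ such that $$U(z+\gamma)=e^{i\langle\gamma,K\rangle}U(z)\ \ (\gamma\in\Lambda),\qquad U(\omega z)=\omega U(z),\qquad \overline{U(\bar z)}=-U(-z).$$ For $\alpha\in\mathbb C$ put $$D(\alpha)=\begin{pmatrix}2D_{\bar z}&\alpha U(z)\\ \alpha U(-z)&2D_{\bar z}\end{pmatrix},\qquad 2D_{\bar z}=\tfrac1i(\partial_x+i\partial_y),\quad z=x+iy,$$ and for $p\in\mathbb C$ let $L^2_p$ be the space of (classes of) functions $u\in L^2_{\rm loc}(\mathbb C;\mathbb C^2)$ with $$\begin{pmatrix}e^{i\langle\gamma,K\rangle}&0\\0&e^{-i\langle\gamma,K\rangle}\end{pmatrix}u(z+\gamma)=e^{i\langle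 p,\gamma\rangle}u(z)\qquad\text{for all }\gamma\in\Lambda .$$ Let $\ker_{L^2_p}D(\alpha)$ be the complex vector space of all $u\in L^2_p$ with $D(\alpha)u=0$ in the sense of distributions; such $u$ are smooth (that is, have a unique smooth representative). The multiplicity of $z_0$ as a zero of $u$ is the order of vanishing of $u$ at $z_0$, i.e. the largest $m$ such that all partial derivatives of $u$ of order less than $m$ vanish at $z_0$. If $u\in\ker_{L^2_p}D(\alpha)$, $u\neq0$, has $k$ zeros in $\mathbb C/\Lambda$, counted with multiplicity, then $$\dim\ker_{L^2_p}D(\alpha)\ \ge\ k .$$ -/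

import Mathlib

open MeasureTheory
open scoped ContDiff

namespace TBG

noncomputable section

/-- The primitive cube root of unity `e^{2πi/3}`. -/
def rot : ℂ := Complex.exp (2 * Real.pi * Complex.I / 3)

/-- The lattice `Λ = ω ℤ ⊕ ℤ`. -/
def lattice : Set ℂ := {γ | ∃ m n : ℤ, γ = m * rot + n}

/-- The dual lattice `Λ* = (4πi/√3) Λ`. -/
def dualLattice : Set ℂ :=
  {k | ∃ γ ∈ lattice, k = (4 * Real.pi * Complex.I / (Real.sqrt 3 : ℂ)) * γ}

/-- The half-open fundamental cell of `Λ`; it contains exactly one point of each class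
of `ℂ/Λ`. -/
def cell : Set ℂ :=
  {z | ∃ s ∈ Set.Ico (0 : ℝ) 1, ∃ t ∈ Set.Ico (0 : ℝ) 1, z = s * rot + t}

/-- The real pairing `⟨z, w⟩ = Re (z w̄)`. -/
def pairing (z w : ℂ) : ℝ := (z * (starRingEnd ℂ) w).re

/-- The unitary phase `e^{i⟨z, w⟩}`. -/
def phase (z w : ℂ) : ℂ := Complex.exp (Complex.I * (pairing z w : ℂ))

/-- `K` is a nonzero fixed point of the rotation by `ω` on `ℂ/Λ*` (e.g. `K = 4π/3`). -/
structure IsDiracPoint (K : ℂ) : Prop where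
  rot_mul_sub : rot * K - K ∈ dualLattice
  not_mem : K ∉ dualLattice

/-- Real analytic potentials on `ℂ = ℝ²` with the symmetries of the chiral model. -/
structure IsPotential (K : ℂ) (U : ℂ → ℂ) : Prop where
  analytic : AnalyticOnNhd ℝ U Set.univ
  translate : ∀ γ ∈ lattice, ∀ z, U (z + γ) = phase γ K * U z
  rotate : ∀ z, U (rot * z) = rot * U z
  conj : ∀ z, (starRingEnd ℂ) (U ((starRingEnd ℂ) z)) = -U (-z)

/-- The fibre `ℂ²`. -/
abbrev C2 : Type := EuclideanSpace ℂ (Fin 2)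

/-- The differential expression `2 D_{z̄} = (1/i) (∂_x + i ∂_y)`, on functions of `z = x + iy`. -/
def twoDbar (φ : ℂ → ℂ) (z : ℂ) : ℂ :=
  (1 / Complex.I) * (fderiv ℝ φ z 1 + Complex.I * fderiv ℝ φ z Complex.I)

/-- The twisted translation
`ℒ_γ u (z) = diag (e^{i⟨γ, K⟩}, e^{-i⟨γ, K⟩}) u (z + γ)`. -/
def twistedTranslate (K γ : ℂ) (u : ℂ → C2) (z : ℂ) : C2 :=
  !₂[phase γ K * u (z + γ) 0, phase (-γ) K * u (z + γ) 1]

/-- Local square integrability. -/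
def LocL2 (u : ℂ → C2) : Prop :=
  ∀ S : Set ℂ, IsCompact S → MemLp u 2 (volume.restrict S)

/-- `D(α) u = 0` in the sense of distributions, where
`D(α) = (2D_{z̄}, αU(z); αU(-z), 2D_{z̄})`; the transpose of `2D_{z̄}` is `-2D_{z̄}`. -/
def WeakKer (U : ℂ → ℂ) (α : ℂ) (u : ℂ → C2) : Prop :=
  ∀ φ : ℂ → ℂ, ContDiff ℝ ∞ φ → HasCompactSupport φ →
    (∫ z, (u z 0 * -twoDbar φ z + α * U z * u z 1 * φ z) = 0) ∧
    (∫ z, (α * U (-z) * u z 0 * φ z + u z 1 * -twoDbar φ z) = 0)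

lemma LocL2.coord {u : ℂ → C2} (hu : LocL2 u) (i : Fin 2) :
    LocallyIntegrable (fun z => u z i) volume := by
  rw [locallyIntegrable_iff]
  intro S hS
  have h := hu S hS
  have : IsFiniteMeasure (volume.restrict S) := ⟨by simpa using hS.measure_lt_top⟩
  have h1 : Integrable u (volume.restrict S) := h.integrable (by norm_num)
  exact (EuclideanSpace.proj (𝕜 := ℂ) i).integrable_comp h1

lemma continuous_twoDbar {φ : ℂ → ℂ} (hφ : ContDiff ℝ ∞ φ) : Continuous (twoDbar φ) := by
  have h : Continuous (fderiv ℝ φ) := hφ.continuous_fderiv (by simp)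
  unfold twoDbar
  fun_prop

lemma hasCompactSupport_twoDbar {φ : ℂ → ℂ} (hφ : HasCompactSupport φ) :
    HasCompactSupport (twoDbar φ) := by
  refine (hφ.fderiv ℝ).mono ?_
  intro z hz h0
  exact hz (by simp [twoDbar, h0])

lemma integrable_mul {f g : ℂ → ℂ} (hf : LocallyIntegrable f volume) (hg : Continuous g)
    (hc : HasCompactSupport g) : Integrable (fun z => f z * g z) := by
  simpa [mul_comm] using hf.integrable_smul_left_of_hasCompactSupport hg hc

lemma integrable_weak {U : ℂ → ℂ} (hU : Continuous U) (α : ℂ) {f g φ : ℂ → ℂ}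
    (hf : LocallyIntegrable f volume) (hg : LocallyIntegrable g volume)
    (hφ : ContDiff ℝ ∞ φ) (hc : HasCompactSupport φ) :
    Integrable (fun z => f z * -twoDbar φ z) ∧
      Integrable (fun z => α * U z * g z * φ z) := by
  constructor
  · simpa using (integrable_mul hf (continuous_twoDbar hφ) (hasCompactSupport_twoDbar hc)).neg
  · have := integrable_mul hg (g := fun z => α * U z * φ z)
      (by have := hφ.continuous; fun_prop) (hc.mul_left)
    refine this.congr (Filter.Eventually.of_forall fun z => ?_)
    simp only; ring

/-- The space `L²_p(ℂ/Λ; ℂ²)` of classes (modulo null sets) `u ∈ L²_loc(ℂ; ℂ²)` such that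
`ℒ_γ u = e^{i⟨p, γ⟩} u` for all `γ ∈ Λ`. -/
def L2p (K p : ℂ) : Submodule ℂ (ℂ →ₘ[volume] C2) where
  carrier := {u | LocL2 u ∧ ∀ γ ∈ lattice, ∀ᵐ z, twistedTranslate K γ u z = phase p γ • u z}
  zero_mem' := by
    have h0 := AEEqFun.coeFn_zero (α := ℂ) (β := C2) (μ := (volume : Measure ℂ))
    refine ⟨fun S _ => ?_, fun γ _ => ?_⟩
    · exact (MemLp.zero' (μ := volume.restrict S)).ae_eq (Filter.EventuallyEq.symm (ae_restrict_of_ae h0))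
    · have h1 := (measurePreserving_add_right volume γ).quasiMeasurePreserving.ae h0
      filter_upwards [h0, h1] with z hz hz1
      ext i
      fin_cases i <;> simp [twistedTranslate, hz, hz1]
  add_mem' := by
    rintro u v ⟨hu, hu'⟩ ⟨hv, hv'⟩
    have h0 := AEEqFun.coeFn_add u v
    refine ⟨fun S hS => ?_, fun γ hγ => ?_⟩
    · exact ((hu S hS).add (hv S hS)).ae_eq (Filter.EventuallyEq.symm (ae_restrict_of_ae h0))
    · have h1 := (measurePreserving_add_right volume γ).quasiMeasurePreserving.ae h0
      filter_upwards [h0, h1, hu' γ hγ, hv' γ hγ] with z hz hz1 hz2 hz3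
      rw [hz, Pi.add_apply, smul_add, ← hz2, ← hz3]
      ext i
      fin_cases i <;> simp [twistedTranslate, hz1, mul_add]
  smul_mem' := by
    rintro c u ⟨hu, hu'⟩
    have h0 := AEEqFun.coeFn_smul c u
    refine ⟨fun S hS => ?_, fun γ hγ => ?_⟩
    · exact ((hu S hS).const_smul c).ae_eq (Filter.EventuallyEq.symm (ae_restrict_of_ae h0))
    · have h1 := (measurePreserving_add_right volume γ).quasiMeasurePreserving.ae h0
      filter_upwards [h0, h1, hu' γ hγ] with z hz hz1 hz2
      rw [hz, Pi.smul_apply, smul_comm, ← hz2]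
      ext i
      fin_cases i <;> simp [twistedTranslate, hz1, mul_left_comm]

/-- The kernel of `D(α)` on `L²_p(ℂ/Λ; ℂ²)`, for a continuous potential. -/
def kerD (K : ℂ) (U : C(ℂ, ℂ)) (α p : ℂ) : Submodule ℂ (ℂ →ₘ[volume] C2) where
  carrier := {u | u ∈ L2p K p ∧ WeakKer U α u}
  zero_mem' := by
    refine ⟨zero_mem _, fun φ _ _ => ?_⟩
    have h0 := AEEqFun.coeFn_zero (α := ℂ) (β := C2) (μ := (volume : Measure ℂ))
    constructor
    · refine integral_eq_zero_of_ae ?_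
      filter_upwards [h0] with z hz
      simp [hz]
    · refine integral_eq_zero_of_ae ?_
      filter_upwards [h0] with z hz
      simp [hz]
  add_mem' := by
    rintro u v ⟨hu, hu'⟩ ⟨hv, hv'⟩
    refine ⟨add_mem hu hv, fun φ hφ hc => ?_⟩
    have h0 := AEEqFun.coeFn_add u v
    have hU' : Continuous fun z => U (-z) := by fun_prop
    obtain ⟨a1, a2⟩ := integrable_weak U.continuous α (hu.1.coord 0) (hu.1.coord 1) hφ hc
    obtain ⟨b1, b2⟩ := integrable_weak U.continuous α (hv.1.coord 0) (hv.1.coord 1) hφ hc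
    obtain ⟨c1, c2⟩ := integrable_weak hU' α (hu.1.coord 1) (hu.1.coord 0) hφ hc
    obtain ⟨d1, d2⟩ := integrable_weak hU' α (hv.1.coord 1) (hv.1.coord 0) hφ hc
    have e1 := integral_add (a1.add a2) (b1.add b2)
    have e2 := integral_add (c2.add c1) (d2.add d1)
    simp only [Pi.add_apply] at e1 e2
    rw [(hu' φ hφ hc).1, (hv' φ hφ hc).1, add_zero] at e1
    rw [(hu' φ hφ hc).2, (hv' φ hφ hc).2, add_zero] at e2
    constructor
    · rw [← e1]
      refine integral_congr_ae ?_
      filter_upwards [h0] with z hz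
      rw [hz]; simp; ring
    · rw [← e2]
      refine integral_congr_ae ?_
      filter_upwards [h0] with z hz
      rw [hz]; simp; ring
  smul_mem' := by
    rintro c u ⟨hu, hu'⟩
    refine ⟨Submodule.smul_mem _ c hu, fun φ hφ hc => ?_⟩
    have h0 := AEEqFun.coeFn_smul c u
    constructor
    · rw [← mul_zero c, ← (hu' φ hφ hc).1, ← integral_const_mul]
      refine integral_congr_ae ?_
      filter_upwards [h0] with z hz
      rw [hz]; simp; ring
    · rw [← mul_zero c, ← (hu' φ hφ hc).2, ← integral_const_mul]
      refine integral_congr_ae ?_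
      filter_upwards [h0] with z hz
      rw [hz]; simp; ring

/-- The multiplicity of `z₀` as a zero of (the class of) `u`: the largest `m` such that the smooth
representative of `u` vanishes at `z₀` with all its derivatives of order `< m` (`0` if `z₀` is not
a zero, `⊤` if there is no largest `m`). Elements of the kernel of the elliptic operator `D(α)`
have a smooth representative, and it is unique. -/
def zeroOrder (u : ℂ →ₘ[volume] C2) (z₀ : ℂ) : ℕ∞ :=
  ⨆ (m : ℕ) (_ : ∃ v : ℂ → C2, ContDiff ℝ ∞ v ∧ u =ᵐ[volume] v ∧
    ∀ j < m, iteratedFDeriv ℝ j v z₀ = 0), (m : ℕ∞)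

/-- The number of zeros of `u` in `ℂ/Λ`, counted with multiplicity. -/
def zeroCount (u : ℂ →ₘ[volume] C2) : ℕ∞ :=
  ⨆ s : Finset cell, ∑ z ∈ s, zeroOrder u z

end

end TBG

namespace TBG

noncomputable section

open Filter Topology

/-! Multiplication by a meromorphic function commutes with `D(α)` away from poles, because the
potential acts pointwise and ∂̄ kills holomorphic factors. So new kernel elements come from
multiplying u by Λ-periodic meromorphic functions whose poles are absorbed by the zeros of u.

Let v be the smooth representative, vanishing to order m a at the points a of a finite set with Σ m
a = k. The product Θ of the θ(z - a)^(m a) (`thetaDivisor`) has exactly these zeros modulo Λ. Theta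
functions of degree k with the multipliers of Θ include k independent ones g_j
(`linearIndependent_thetaBasis`). Each g_j/Θ is Λ-periodic, so (g_j/Θ)v obeys the same twisted
periodicity as v. It is locally bounded, since v = O(|z - a|^(m a)) by Taylor and θ has simple zeros
(`div_thetaDivisor_smul_bound`).

The analytic point is that the equation survives in the sense of distributions across the zeros of Θ
(`weak_dbar_div`): 1/Θ is regularised as n S(nΘ) with S smooth and S(w) = 1/w for large |w|, and the
error is dominated by |Θ'/Θ|, which is locally integrable in the plane. Independence passes from the
g_j to the (g_j/Θ)v by unique continuation for entire functions (`linearIndependent_mk_smul`). -/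

/-! ### The theta function of degree one. -/

/-- The infinite product `∏ (1 - qⁿ y)`. -/
def qProd (q y : ℂ) : ℂ := ∏' n : ℕ, (1 + -(q ^ n * y))

lemma summable_qProd {q : ℂ} (hq : ‖q‖ < 1) (y : ℂ) : Summable fun n : ℕ => ‖-(q ^ n * y)‖ := by
  simp only [norm_neg, norm_mul, norm_pow]
  exact (summable_geometric_of_lt_one (norm_nonneg _) hq).mul_right _

lemma differentiable_qProd {q : ℂ} (hq : ‖q‖ < 1) : Differentiable ℂ (qProd q) := by
  rw [← differentiableOn_univ]
  have h : HasProdLocallyUniformlyOn (fun (n : ℕ) (y : ℂ) => 1 + -(q ^ n * y)) (qProd q)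
      Set.univ := by
    refine hasProdLocallyUniformlyOn_of_forall_compact isOpen_univ fun S _ hS => ?_
    obtain ⟨C, hC⟩ := hS.isBounded.exists_norm_le
    refine ((summable_geometric_of_lt_one (norm_nonneg _) hq).mul_right
      C).hasProdUniformlyOn_nat_one_add hS (.of_forall fun n y hy => ?_) fun _ => by fun_prop
    rw [norm_neg, norm_mul, norm_pow]
    exact mul_le_mul_of_nonneg_left (hC y hy) (by positivity)
  exact h.differentiableOn
    (.of_forall fun _ => by
      simpa [Finset.prod_fn] using DifferentiableOn.finsetProd (fun _ _ => by fun_prop)) isOpen_univ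

lemma qProd_eq_mul {q : ℂ} (hq : ‖q‖ < 1) (y : ℂ) : qProd q y = (1 - y) * qProd q (q * y) := by
  have h := (multipliable_one_add_of_summable (summable_qProd hq (q * y)))
  unfold qProd
  rw [tprod_eq_zero_mul' (f := fun n : ℕ => (1 + -(q ^ n * y)))
    (by simpa [pow_succ, mul_assoc] using h)]
  simp [pow_succ, mul_assoc, sub_eq_add_neg]

/-- An absolutely convergent product of nonzero factors is nonzero. Conversely, the functional
equation moves a vanishing factor down to index 0. -/
lemma qProd_eq_zero_iff {q : ℂ} (hq : ‖q‖ < 1) (y : ℂ) :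
    qProd q y = 0 ↔ ∃ n : ℕ, q ^ n * y = 1 := by
  constructor
  · contrapose!
    intro h
    exact tprod_one_add_ne_zero_of_summable
      (fun n h0 => h n (by linear_combination -h0)) (summable_qProd hq y)
  · rintro ⟨n, hn⟩
    induction n generalizing y with
    | zero =>
      rw [pow_zero, one_mul] at hn
      rw [qProd_eq_mul hq, hn]; ring
    | succ n ih => rw [qProd_eq_mul hq, ih (q * y) (by rw [← hn]; ring), mul_zero]

/-- The exponential `e^{2πiz}`. -/
def exp2pi (z : ℂ) : ℂ := Complex.exp (2 * Real.pi * Complex.I * z)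

lemma exp2pi_add (z w : ℂ) : exp2pi (z + w) = exp2pi z * exp2pi w := by
  rw [exp2pi, mul_add, Complex.exp_add]; rfl

lemma exp2pi_ne_zero (z : ℂ) : exp2pi z ≠ 0 := Complex.exp_ne_zero _

lemma exp2pi_neg (z : ℂ) : exp2pi (-z) = (exp2pi z)⁻¹ := by
  rw [exp2pi, mul_neg, Complex.exp_neg]; rfl

lemma exp2pi_sub (z w : ℂ) : exp2pi (z - w) = exp2pi z / exp2pi w := by
  rw [sub_eq_add_neg, exp2pi_add, exp2pi_neg]; rfl

lemma exp2pi_natCast_mul (n : ℕ) (z : ℂ) : exp2pi (n * z) = exp2pi z ^ n := by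
  rw [exp2pi, exp2pi, ← Complex.exp_nat_mul]; ring_nf

lemma exp2pi_eq_one_iff (z : ℂ) : exp2pi z = 1 ↔ ∃ n : ℤ, z = n := by
  rw [exp2pi, Complex.exp_eq_one_iff]
  have := Complex.two_pi_I_ne_zero
  refine exists_congr fun n => ⟨fun h => mul_left_cancel₀ this (by rw [h]; ring), ?_⟩
  rintro rfl; ring

lemma exp2pi_one : exp2pi 1 = 1 := (exp2pi_eq_one_iff 1).2 ⟨1, by simp⟩

lemma differentiable_exp2pi : Differentiable ℂ exp2pi := by unfold exp2pi; fun_prop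

lemma exists_exp2pi_eq {w : ℂ} (hw : w ≠ 0) : ∃ c, exp2pi c = w := by
  refine ⟨Complex.log w / (2 * Real.pi * Complex.I), ?_⟩
  rw [exp2pi, mul_div_cancel₀ _ Complex.two_pi_I_ne_zero, Complex.exp_log hw]

lemma norm_exp2pi_lt_one {τ : ℂ} (hτ : 0 < τ.im) : ‖exp2pi τ‖ < 1 := by
  rw [exp2pi, Complex.norm_exp, Real.exp_lt_one_iff]
  simpa using by positivity

/-- The theta function with simple zeros exactly at `ℤ + τℤ`, as a product. -/
def theta (τ z : ℂ) : ℂ := qProd (exp2pi τ) (exp2pi z) * qProd (exp2pi τ) (exp2pi (τ - z))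

lemma differentiable_theta {τ : ℂ} (hτ : 0 < τ.im) : Differentiable ℂ (theta τ) := by
  have h1 := differentiable_qProd (norm_exp2pi_lt_one hτ)
  have h2 := differentiable_exp2pi
  unfold theta
  fun_prop

lemma theta_add_one (τ z : ℂ) : theta τ (z + 1) = theta τ z := by
  rw [theta, exp2pi_add, exp2pi_one, mul_one, ← sub_sub, exp2pi_sub _ 1, exp2pi_one, div_one]; rfl

/-- The shift by τ removes the factor 1 - e^{2πiz} from the first product and adds 1 - e^{-2πiz} to
the second; their ratio is -e^{-2πiz}. -/
lemma theta_add_period {τ : ℂ} (hτ : 0 < τ.im) (z : ℂ) : theta τ (z + τ) = -exp2pi (-z) * theta τ z := by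
  have hq := norm_exp2pi_lt_one hτ
  have e1 := qProd_eq_mul hq (exp2pi z)
  have e2 := qProd_eq_mul hq (exp2pi (-z))
  rw [← exp2pi_add] at e1 e2
  rw [theta, theta, show τ - (z + τ) = -z by ring, show z + τ = τ + z by ring,
    show τ - z = τ + -z by ring, e1, e2, exp2pi_neg]
  have := exp2pi_ne_zero z
  field_simp
  ring

lemma theta_eq_zero_iff {τ : ℂ} (hτ : 0 < τ.im) (z : ℂ) : theta τ z = 0 ↔ ∃ m n : ℤ, z = m * τ + n := by
  have hq := norm_exp2pi_lt_one hτ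
  rw [theta, mul_eq_zero, qProd_eq_zero_iff hq, qProd_eq_zero_iff hq]
  simp only [← exp2pi_natCast_mul, ← exp2pi_add, exp2pi_eq_one_iff]
  constructor
  · rintro (⟨n, l, h⟩ | ⟨n, l, h⟩)
    · exact ⟨-n, l, by push_cast; linear_combination h⟩
    · exact ⟨n + 1, -l, by push_cast; linear_combination -h⟩
  · rintro ⟨m, n, rfl⟩
    -- The first product vanishes on the rows m ≤ 0, the second on the rows m ≥ 1.
    rcases le_or_gt m 0 with hm | hm
    · lift -m to ℕ using (by omega) with l hl
      refine Or.inl ⟨l, n, ?_⟩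
      have : (l : ℂ) = -m := by exact_mod_cast congrArg (Int.cast (R := ℂ)) hl
      rw [this]; ring
    · lift m - 1 to ℕ using (by omega) with l hl
      refine Or.inr ⟨l, -n, ?_⟩
      have : (l : ℂ) = m - 1 := by exact_mod_cast congrArg (Int.cast (R := ℂ)) hl
      rw [this]; push_cast; ring

lemma exists_theta_ne_zero {τ : ℂ} (hτ : 0 < τ.im) : ∃ z, theta τ z ≠ 0 := by
  refine ⟨τ / 2, fun h => ?_⟩
  obtain ⟨m, n, h⟩ := (theta_eq_zero_iff hτ _).1 h
  have h := congrArg Complex.im h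
  rw [show τ / 2 = (1 / 2 : ℝ) * τ by push_cast; ring, Complex.im_ofReal_mul, Complex.add_im,
    Complex.intCast_im, add_zero, ← Complex.ofReal_intCast, Complex.im_ofReal_mul] at h
  have h := mul_right_cancel₀ hτ.ne' h
  have : (1 : ℝ) = ((2 * m : ℤ) : ℝ) := by push_cast; linarith
  have : (1 : ℤ) = 2 * m := by exact_mod_cast this
  omega

/-- The zero of `theta` at the origin is simple. -/
lemma theta_lower_bound {τ : ℂ} (hτ : 0 < τ.im) :
    ∃ c > 0, ∀ᶠ z in 𝓝 (0 : ℂ), c * ‖z‖ ≤ ‖theta τ z‖ := by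
  have hq := norm_exp2pi_lt_one hτ
  -- This is the cofactor of 1 - e^{2πiz} in θ; its value at 0 is a nonzero square, so θ'(0) ≠ 0.
  have hd : Differentiable ℂ fun z =>
      qProd (exp2pi τ) (exp2pi (τ + z)) * qProd (exp2pi τ) (exp2pi (τ - z)) := by
    have h1 := differentiable_qProd hq
    have h2 := differentiable_exp2pi
    fun_prop
  have hne : qProd (exp2pi τ) (exp2pi τ) ≠ 0 := by
    rw [Ne, qProd_eq_zero_iff hq]
    rintro ⟨n, hn⟩
    have := congrArg norm hn
    rw [← pow_succ, norm_pow, norm_one] at this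
    exact (pow_lt_one₀ (norm_nonneg _) hq n.succ_ne_zero).ne this
  have h1 : HasDerivAt (fun z => 1 - exp2pi z) (-(2 * Real.pi * Complex.I)) 0 := by
    have : HasDerivAt exp2pi (2 * Real.pi * Complex.I) 0 := by
      have := ((hasDerivAt_id (0 : ℂ)).const_mul (2 * Real.pi * Complex.I)).cexp
      exact this.congr_deriv (by simp)
    exact this.const_sub 1
  have h2 := h1.mul (hd 0).hasDerivAt
  have e : theta τ = fun z => (1 - exp2pi z) *
      (qProd (exp2pi τ) (exp2pi (τ + z)) * qProd (exp2pi τ) (exp2pi (τ - z))) := by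
    funext z
    rw [theta, qProd_eq_mul hq (exp2pi z), ← exp2pi_add, mul_assoc]
  have h3 : HasDerivAt (theta τ) (-(2 * Real.pi * Complex.I) *
      (qProd (exp2pi τ) (exp2pi τ) * qProd (exp2pi τ) (exp2pi τ))) 0 := by
    rw [e]
    refine h2.congr_deriv ?_
    simp [exp2pi]
  have h4 := mul_ne_zero (neg_ne_zero.2 Complex.two_pi_I_ne_zero) (mul_ne_zero hne hne)
  have h0 : theta τ 0 = 0 := (theta_eq_zero_iff hτ 0).2 ⟨0, 0, by simp⟩
  obtain ⟨C, hC, hb⟩ := (h3.isTheta_sub h4).isBigO_symm.exists_pos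
  refine ⟨C⁻¹, inv_pos.2 hC, ?_⟩
  have hb' := hb.bound
  rw [Filter.prod_pure, Filter.eventually_map] at hb'
  filter_upwards [hb'] with z hz
  rw [h0, sub_zero, sub_zero] at hz
  rwa [inv_mul_le_iff₀ hC]

/-! ### Theta functions of degree k. -/

/-- `k` entire functions with the multipliers of a theta function of degree `k`. -/
def thetaBasis (τ c : ℂ) (k j : ℕ) (z : ℂ) : ℂ :=
  exp2pi (j * z) * theta (k * τ) (k * z + (j * τ + c))

lemma thetaBasis_add_one (τ c : ℂ) (k j : ℕ) (z : ℂ) :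
    thetaBasis τ c k j (z + 1) = thetaBasis τ c k j z := by
  have h : ∀ (n : ℕ) (w : ℂ), theta (k * τ) (w + n) = theta (k * τ) w := by
    intro n w
    induction n with
    | zero => simp
    | succ n ih => rw [Nat.cast_succ, ← add_assoc, theta_add_one, ih]
  rw [thetaBasis, mul_add, exp2pi_add, mul_one, ← mul_one (j : ℂ), exp2pi_natCast_mul j 1,
    exp2pi_one, one_pow, mul_one, mul_one,
    show (k : ℂ) * (z + 1) + (j * τ + c) = k * z + (j * τ + c) + k by ring, h]
  rfl

lemma im_natCast_mul_pos {τ : ℂ} (hτ : 0 < τ.im) {k : ℕ} (hk : 0 < k) :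
    0 < ((k : ℂ) * τ).im := by
  rw [← Complex.ofReal_natCast, Complex.im_ofReal_mul]; positivity

/-- The factor e^{2πijτ} from the exponential cancels the one from the shift jτ inside θ, so the
multiplier does not depend on j. -/
lemma thetaBasis_add_period {τ : ℂ} (hτ : 0 < τ.im) (c : ℂ) {k : ℕ} (hk : 0 < k) (j : ℕ) (z : ℂ) :
    thetaBasis τ c k j (z + τ) = -exp2pi (-(k * z + c)) * thetaBasis τ c k j z := by
  have hτk := im_natCast_mul_pos hτ hk
  rw [thetaBasis, show (k : ℂ) * (z + τ) + (j * τ + c) = k * z + (j * τ + c) + k * τ by ring,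
    theta_add_period hτk, thetaBasis, mul_add, exp2pi_add,
    show -((k : ℂ) * z + (j * τ + c)) = -(k * z + c) + -(j * τ) by ring, exp2pi_add,
    exp2pi_neg (j * τ)]
  have := exp2pi_ne_zero (j * τ)
  field_simp

lemma differentiable_thetaBasis {τ : ℂ} (hτ : 0 < τ.im) (c : ℂ) {k : ℕ} (hk : 0 < k) (j : ℕ) :
    Differentiable ℂ (thetaBasis τ c k j) := by
  have h1 := differentiable_theta (im_natCast_mul_pos hτ hk)
  have h2 := differentiable_exp2pi
  unfold thetaBasis
  fun_prop

/-- Translation by 1/k moves the argument of θ by its period 1, so these are eigenvectors with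
eigenvalues e^{2πij/k}, distinct for 0 ≤ j < k. -/
lemma linearIndependent_thetaBasis {τ : ℂ} (hτ : 0 < τ.im) (c : ℂ) {k : ℕ} (hk : 0 < k) :
    LinearIndependent ℂ fun j : Fin k => thetaBasis τ c k j := by
  have hk' : (k : ℂ) ≠ 0 := by exact_mod_cast hk.ne'
  let T : Module.End ℂ (ℂ → ℂ) := LinearMap.funLeft ℂ ℂ fun z => z + 1 / k
  refine T.eigenvectors_linearIndependent' (fun j : Fin k => exp2pi (j * (1 / k))) ?_ _ ?_
  · intro i j h
    simp only at h
    have h1 : exp2pi (i * (1 / k) - j * (1 / k)) = 1 := by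
      rw [exp2pi_sub, h, div_self (exp2pi_ne_zero _)]
    obtain ⟨n, hn⟩ := (exp2pi_eq_one_iff _).1 h1
    field_simp at hn
    have h2 : (i : ℤ) - j = k * n := by exact_mod_cast hn
    have hi := i.2
    have hj := j.2
    have : ((i : ℕ) : ℤ) = j := by
      have h3 : (i : ℤ) - j = 0 :=
        Int.eq_zero_of_abs_lt_dvd ⟨n, h2⟩ (abs_lt.2 ⟨by omega, by omega⟩)
      omega
    exact Fin.ext (by exact_mod_cast this)
  · intro j
    refine Module.End.hasEigenvector_iff.2 ⟨Module.End.mem_eigenspace_iff.2 ?_, ?_⟩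
    · funext z
      simp only [T, LinearMap.funLeft_apply, Pi.smul_apply, smul_eq_mul, thetaBasis]
      rw [mul_add, exp2pi_add, show (k : ℂ) * (z + 1 / k) + (j * τ + c) = k * z + (j * τ + c) + 1 by
        field_simp; ring, theta_add_one]
      ring
    · intro h0
      obtain ⟨w, hw⟩ := exists_theta_ne_zero (im_natCast_mul_pos hτ hk)
      have h1 := congrFun h0 ((w - (j * τ + c)) / k)
      rw [thetaBasis, mul_div_cancel₀ _ hk', sub_add_cancel] at h1
      exact (mul_ne_zero (exp2pi_ne_zero _) hw) h1

/-! ### Zeros and logarithmic derivatives of entire functions. -/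

lemma Differentiable.ae_ne_zero {f : ℂ → ℂ} (hf : Differentiable ℂ f) {x : ℂ} (hx : f x ≠ 0) :
    ∀ᵐ z, f z ≠ 0 := by
  have h := AnalyticOnNhd.preimage_zero_mem_codiscrete
    (fun z _ => hf.analyticAt z : AnalyticOnNhd ℂ f Set.univ) hx
  have h2 := ae_restrict_le_codiscreteWithin (μ := volume) (U := (Set.univ : Set ℂ))
    MeasurableSet.univ h
  rw [Measure.restrict_univ] at h2
  filter_upwards [h2] with z hz using hz

/-- The logarithmic derivative of an entire function has at most simple poles. -/
lemma Differentiable.deriv_div_bound {f : ℂ → ℂ} (hf : Differentiable ℂ f) {x : ℂ} (hx : f x ≠ 0)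
    (z₀ : ℂ) : ∃ C, ∀ᶠ z in 𝓝[≠] z₀, ‖deriv f z / f z‖ ≤ C * ‖z - z₀‖⁻¹ := by
  have hne : ¬∀ᶠ z in 𝓝 z₀, f z = 0 := fun h => hx <|
    AnalyticOnNhd.eqOn_zero_of_preconnected_of_eventuallyEq_zero
      (fun z _ => hf.analyticAt z : AnalyticOnNhd ℂ f Set.univ) isPreconnected_univ
      (Set.mem_univ z₀) h (Set.mem_univ x)
  obtain ⟨n, g, hg, hg0, he⟩ := (hf.analyticAt z₀).exists_eventuallyEq_pow_smul_nonzero_iff.2 hne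
  -- With f = (z - z₀)^n g, the function inside the norm is (z - z₀) f'/f off z₀.
  have hc : ContinuousAt (fun z => ‖n + (z - z₀) * (deriv g z / g z)‖) z₀ := by
    have h1 := hg.deriv.continuousAt
    have h2 := hg.continuousAt
    fun_prop (disch := assumption)
  refine ⟨‖(n : ℂ) + (z₀ - z₀) * (deriv g z₀ / g z₀)‖ + 1, ?_⟩
  filter_upwards [nhdsWithin_le_nhds (hc.eventually_le_const (lt_add_one _)),
    nhdsWithin_le_nhds (hg.continuousAt.eventually_ne hg0),
    nhdsWithin_le_nhds he.eventually_nhds,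
    nhdsWithin_le_nhds hg.eventually_analyticAt, self_mem_nhdsWithin]
    with z h1 h2 h3 h4 h5
  have h6 : z - z₀ ≠ 0 := sub_ne_zero.2 h5
  have hd : deriv f z = n * (z - z₀) ^ (n - 1) * g z + (z - z₀) ^ n * deriv g z := by
    rw [EventuallyEq.deriv_eq h3]
    have := (((hasDerivAt_id z).sub_const z₀).pow n).mul h4.differentiableAt.hasDerivAt
    exact this.deriv.trans (by simp)
  have hfz : f z = (z - z₀) ^ n * g z := h3.self_of_nhds
  have key : deriv f z / f z = (n + (z - z₀) * (deriv g z / g z)) * (z - z₀)⁻¹ := by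
    rw [hd, hfz]
    -- The exponent n - 1 is truncated at n = 0, where its coefficient n vanishes.
    rcases n with _ | n
    · field_simp
      simp
    · rw [Nat.add_sub_cancel, pow_succ]
      field_simp
  rw [key, norm_mul, norm_inv]
  exact mul_le_mul_of_nonneg_right h1 (by positivity)

/-- In polar coordinates the Jacobian r cancels 1/r. -/
lemma integrableOn_inv_norm_sub (z₀ : ℂ) (r : ℝ) :
    IntegrableOn (fun z => ‖z - z₀‖⁻¹) (Metric.ball z₀ r) := by
  have h : IntegrableOn (fun z : ℂ => ‖z‖⁻¹) (Metric.ball 0 r) := by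
    rw [integrableOn_fun_norm_addHaar volume (f := fun y : ℝ => y⁻¹)]
    have h1 : IntegrableOn (fun _ : ℝ => (1 : ℝ)) (Set.Ioo 0 r) := by simp
    refine h1.congr_fun (fun y hy => ?_) measurableSet_Ioo
    simp [mul_inv_cancel₀ hy.1.ne']
  have h2 := (measurePreserving_sub_right volume z₀).integrableOn_comp_preimage
    (measurableEmbedding_subRight z₀) (f := fun z : ℂ => ‖z‖⁻¹) (s := Metric.ball 0 r)
  have h3 : (fun z => z - z₀) ⁻¹' Metric.ball 0 r = Metric.ball z₀ r := by
    ext z; simp [dist_eq_norm]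
  rw [h3] at h2
  exact h2.2 h

lemma locallyIntegrable_of_simple_poles {f : ℂ → ℂ} (hm : Measurable f)
    (h : ∀ z₀, ∃ C, ∀ᶠ z in 𝓝[≠] z₀, ‖f z‖ ≤ C * ‖z - z₀‖⁻¹) : LocallyIntegrable f := by
  intro z₀
  obtain ⟨C, hC⟩ := h z₀
  rw [eventually_nhdsWithin_iff] at hC
  obtain ⟨r, hr, hb⟩ := Metric.nhds_basis_ball.eventually_iff.1 hC
  refine ⟨Metric.ball z₀ r, Metric.ball_mem_nhds z₀ hr, ?_⟩
  refine Integrable.mono' ((integrableOn_inv_norm_sub z₀ r).const_mul C)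
    hm.aestronglyMeasurable ?_
  have h0 : ∀ᵐ z ∂(volume.restrict (Metric.ball z₀ r)), z ≠ z₀ :=
    ae_restrict_of_ae (Measure.ae_ne volume z₀)
  filter_upwards [h0, ae_restrict_mem Metric.isOpen_ball.measurableSet] with z hz hzb
  exact hb hzb hz

lemma Differentiable.locallyIntegrable_deriv_div {f : ℂ → ℂ} (hf : Differentiable ℂ f) {x : ℂ}
    (hx : f x ≠ 0) : LocallyIntegrable fun z => deriv f z / f z :=
  locallyIntegrable_of_simple_poles ((measurable_deriv f).div hf.continuous.measurable)
    (Differentiable.deriv_div_bound hf hx)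

/-! ### Calculus of ∂̄ and a smoothed reciprocal. -/

lemma twoDbar_mul {f g : ℂ → ℂ} {z : ℂ} (hf : DifferentiableAt ℝ f z)
    (hg : DifferentiableAt ℝ g z) :
    twoDbar (fun z => f z * g z) z = f z * twoDbar g z + g z * twoDbar f z := by
  rw [twoDbar, fderiv_fun_mul hf hg]
  simp only [add_apply, smul_apply, smul_eq_mul, twoDbar]
  ring

/-- The differential of f is multiplication by f'; the antilinear part of dH, precomposed with it,
picks up the conjugate of f'. -/
lemma twoDbar_comp {H f : ℂ → ℂ} {z : ℂ} (hH : DifferentiableAt ℝ H (f z))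
    (hf : DifferentiableAt ℂ f z) :
    twoDbar (fun z => H (f z)) z = (starRingEnd ℂ) (deriv f z) * twoDbar H (f z) := by
  have h1 : HasFDerivAt f ((fderiv ℂ f z).restrictScalars ℝ) z :=
    hf.hasFDerivAt.restrictScalars ℝ
  have h2 : HasFDerivAt (fun z => H (f z)) _ z := hH.hasFDerivAt.comp z h1
  have e : ∀ w : ℂ, fderiv ℝ H (f z) w = w.re * fderiv ℝ H (f z) 1 +
      w.im * fderiv ℝ H (f z) Complex.I := by
    intro w
    conv_lhs => rw [show w = w.re • (1 : ℂ) + w.im • Complex.I by simp [Complex.re_add_im]]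
    rw [map_add, map_smul, map_smul]; simp
  have e1 : ∀ w, fderiv ℂ f z w = w * deriv f z := fun w => by
    rw [← fderiv_apply_one_eq_deriv]; simp
  rw [twoDbar, h2.fderiv]
  simp only [ContinuousLinearMap.comp_apply, ContinuousLinearMap.coe_restrictScalars', e1, twoDbar,
    one_mul]
  rw [e (deriv f z), e (Complex.I * deriv f z)]
  conv_rhs => rw [← Complex.re_add_im (deriv f z)]
  simp only [Complex.mul_re, Complex.mul_im, Complex.I_re, Complex.I_im, map_add, map_mul,
    Complex.conj_ofReal, Complex.conj_I]
  push_cast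
  ring_nf
  rw [Complex.I_sq]
  ring

lemma twoDbar_eq_zero {f : ℂ → ℂ} {z : ℂ} (hf : DifferentiableAt ℂ f z) : twoDbar f z = 0 := by
  have h := twoDbar_comp (H := fun w => w) differentiableAt_fun_id hf
  have h1 : twoDbar (fun w : ℂ => w) (f z) = 0 := by
    simp [twoDbar]
  rwa [h1, mul_zero] at h

/-- A smooth function on `ℂ` equal to `1 / w` for `2 ≤ |w|`. -/
def smoothInv (w : ℂ) : ℂ :=
  (1 - ((⟨1, 2, one_pos, one_lt_two⟩ : ContDiffBump (0 : ℂ)) w : ℂ)) / w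

lemma contDiff_smoothInv : ContDiff ℝ ∞ smoothInv := by
  rw [contDiff_iff_contDiffAt]
  intro w
  set b : ContDiffBump (0 : ℂ) := ⟨1, 2, one_pos, one_lt_two⟩
  rcases eq_or_ne w 0 with rfl | hw
  · have h : smoothInv =ᶠ[𝓝 0] fun _ => 0 := by
      filter_upwards [b.eventuallyEq_one] with w hw
      change (1 - (b w : ℂ)) / w = 0
      rw [hw]; simp
    exact contDiffAt_const.congr_of_eventuallyEq h
  · have h1 : ContDiffAt ℝ ∞ (fun w => (b w : ℂ)) w :=
      Complex.ofRealCLM.contDiff.contDiffAt.comp w b.contDiffAt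
    exact (contDiffAt_const.sub h1).mul (contDiffAt_id.inv hw)

lemma smoothInv_eq {w : ℂ} (hw : 2 ≤ ‖w‖) : smoothInv w = w⁻¹ := by
  have : (⟨1, 2, one_pos, one_lt_two⟩ : ContDiffBump (0 : ℂ)) w = 0 :=
    ContDiffBump.zero_of_le_dist _ (by simpa using hw)
  rw [smoothInv, this]; simp

lemma norm_mul_smoothInv_le (w : ℂ) : ‖w * smoothInv w‖ ≤ 1 := by
  rcases eq_or_ne w 0 with rfl | hw
  · simp
  set b : ContDiffBump (0 : ℂ) := ⟨1, 2, one_pos, one_lt_two⟩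
  have : w * smoothInv w = ((1 - b w : ℝ) : ℂ) := by
    change w * ((1 - (b w : ℂ)) / w) = _
    rw [mul_div_cancel₀ _ hw]; push_cast; rfl
  rw [this, Complex.norm_real, Real.norm_eq_abs, abs_le]
  have h1 := b.nonneg' w
  have h2 : b w ≤ 1 := b.le_one
  constructor <;> linarith

lemma twoDbar_smoothInv {w : ℂ} (hw : 2 < ‖w‖) : twoDbar smoothInv w = 0 := by
  have h : smoothInv =ᶠ[𝓝 w] fun w => w⁻¹ := by
    filter_upwards [continuous_norm.continuousAt.eventually_const_lt hw] with z hz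
      using smoothInv_eq hz.le
  have h0 : w ≠ 0 := norm_pos_iff.1 (two_pos.trans hw)
  have h1 := twoDbar_eq_zero (differentiableAt_inv h0)
  rw [twoDbar, h.fderiv_eq]
  exact h1

/-- The function is holomorphic for |w| > 2, so only a compact disc matters. The weight w² is the
one produced by differentiating n S(nΘ) in `weak_dbar_div`. -/
lemma exists_twoDbar_smoothInv_bound : ∃ M, ∀ w, ‖w ^ 2 * twoDbar smoothInv w‖ ≤ M := by
  have hc : Continuous fun w => w ^ 2 * twoDbar smoothInv w := by
    have := continuous_twoDbar contDiff_smoothInv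
    fun_prop
  obtain ⟨M, hM⟩ := (isCompact_closedBall (0 : ℂ) 2).exists_bound_of_continuousOn hc.continuousOn
  refine ⟨max M 0, fun w => ?_⟩
  rcases le_or_gt ‖w‖ 2 with hw | hw
  · exact (hM w (by simpa using hw)).trans (le_max_left _ _)
  · rw [twoDbar_smoothInv hw]; simp

/-! ### Dividing a distributional ∂̄-equation by an entire function. -/

lemma exists_bound_on_compact {f : ℂ → ℂ} (hf : ∀ z₀, ∃ C, ∀ᶠ z in 𝓝 z₀, ‖f z‖ ≤ C) {S : Set ℂ}
    (hS : IsCompact S) : ∃ C, ∀ z ∈ S, ‖f z‖ ≤ C := by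
  refine hS.induction_on (p := fun S => ∃ C, ∀ z ∈ S, ‖f z‖ ≤ C) ⟨0, by simp⟩ ?_ ?_ ?_
  · rintro s t hst ⟨C, hC⟩
    exact ⟨C, fun z hz => hC z (hst hz)⟩
  · rintro s t ⟨C, hC⟩ ⟨C', hC'⟩
    refine ⟨max C C', ?_⟩
    rintro z (hz | hz)
    · exact (hC z hz).trans (le_max_left _ _)
    · exact (hC' z hz).trans (le_max_right _ _)
  · intro z₀ _
    obtain ⟨C, hC⟩ := hf z₀
    exact ⟨_, mem_nhdsWithin_of_mem_nhds hC, C, fun z hz => hz⟩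

/-- A distributional equation `2D_{z̄} a + b = 0` may be multiplied by a meromorphic function `g / Θ`
as long as the products stay locally bounded. -/
lemma weak_dbar_div {a b Θ g : ℂ → ℂ} (ha : Continuous a) (hb : Continuous b)
    (hΘ : Differentiable ℂ Θ) (hg : Differentiable ℂ g) {x : ℂ} (hx : Θ x ≠ 0)
    (ha' : ∀ z₀, ∃ C, ∀ᶠ z in 𝓝 z₀, ‖g z / Θ z * a z‖ ≤ C)
    (hb' : ∀ z₀, ∃ C, ∀ᶠ z in 𝓝 z₀, ‖g z / Θ z * b z‖ ≤ C)
    (h : ∀ φ : ℂ → ℂ, ContDiff ℝ ∞ φ → HasCompactSupport φ →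
      ∫ z, (a z * -twoDbar φ z + b z * φ z) = 0)
    {φ : ℂ → ℂ} (hφ : ContDiff ℝ ∞ φ) (hc : HasCompactSupport φ) :
    ∫ z, (g z / Θ z * a z * -twoDbar φ z + g z / Θ z * b z * φ z) = 0 := by
  obtain ⟨Ca, hCa⟩ := exists_bound_on_compact ha' hc
  obtain ⟨Cb, hCb⟩ := exists_bound_on_compact hb' hc
  obtain ⟨M, hM⟩ := exists_twoDbar_smoothInv_bound
  have hΘR : ContDiff ℝ ∞ Θ := hΘ.contDiff.restrict_scalars ℝ
  have hgR : ContDiff ℝ ∞ g := hg.contDiff.restrict_scalars ℝ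
  -- A smooth substitute for g/Θ, equal to it wherever n|Θ| ≥ 2; hence G n φ is an admissible test
  -- function.
  set G : ℕ → ℂ → ℂ := fun n z => n * g z * smoothInv (n * Θ z) with hG
  have hGs : ∀ n, ContDiff ℝ ∞ (G n) := fun n =>
    (contDiff_const.mul hgR).mul (contDiff_smoothInv.comp (contDiff_const.mul hΘR))
  have hGd : ∀ n z, twoDbar (G n) z =
      n * g z * (n * (starRingEnd ℂ) (deriv Θ z) * twoDbar smoothInv (n * Θ z)) := by
    intro n z
    have d1 : DifferentiableAt ℂ (fun z => n * Θ z) z := (hΘ z).const_mul _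
    have d2 : DifferentiableAt ℂ (fun z => n * g z) z := (hg z).const_mul _
    have d3 : DifferentiableAt ℝ smoothInv (n * Θ z) :=
      contDiff_smoothInv.differentiable (by simp) _
    rw [hG]
    rw [twoDbar_mul (f := fun z => n * g z) (g := fun z => smoothInv (n * Θ z))
      (d2.restrictScalars ℝ) (DifferentiableAt.fun_comp' z d3 (d1.restrictScalars ℝ)),
      twoDbar_eq_zero d2, twoDbar_comp (f := fun z => n * Θ z) d3 d1, deriv_const_mul _ (hΘ z)]
    simp
  have hae := Differentiable.ae_ne_zero hΘ hx
  set F : ℕ → ℂ → ℂ := fun n z =>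
    a z * -twoDbar (fun z => G n z * φ z) z + b z * (G n z * φ z) with hF
  have hF0 : ∀ n, ∫ z, F n z = 0 := fun n => h _ ((hGs n).mul hφ) hc.mul_left
  -- The first term carries a factor bounded by 1 that tends to 1. The second is the error from ∂̄
  -- of the regularisation: it lives on n|Θ| ≤ 2 and is bounded by a multiple of |Θ'/Θ|.
  have hFe : ∀ n z, Θ z ≠ 0 → F n z =
      (n * Θ z * smoothInv (n * Θ z)) * (g z / Θ z * a z * -twoDbar φ z + g z / Θ z * b z * φ z)
      - ((n * Θ z) ^ 2 * twoDbar smoothInv (n * Θ z)) * ((starRingEnd ℂ) (deriv Θ z) / Θ z) *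
        (g z / Θ z * a z * φ z) := by
    intro n z hz
    simp only [hF]
    rw [twoDbar_mul ((hGs n).differentiable (by simp) z) (hφ.differentiable (by simp) z), hGd, hG]
    field_simp
    ring
  have hba : ∀ (ψ : ℂ → ℂ), (∀ z, z ∉ tsupport φ → ψ z = 0) → ∀ z,
      ‖g z / Θ z * a z * ψ z‖ ≤ Ca * ‖ψ z‖ := by
    intro ψ hψ z
    by_cases hz : z ∈ tsupport φ
    · rw [norm_mul]; exact mul_le_mul_of_nonneg_right (hCa z hz) (norm_nonneg _)
    · rw [hψ z hz]; simp
  have hbb : ∀ z, ‖g z / Θ z * b z * φ z‖ ≤ Cb * ‖φ z‖ := by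
    intro z
    by_cases hz : z ∈ tsupport φ
    · rw [norm_mul]; exact mul_le_mul_of_nonneg_right (hCb z hz) (norm_nonneg _)
    · rw [image_eq_zero_of_notMem_tsupport hz]; simp
  have hφ0 : ∀ z, z ∉ tsupport φ → φ z = 0 := fun z hz => image_eq_zero_of_notMem_tsupport hz
  have hdφ0 : ∀ z, z ∉ tsupport φ → -twoDbar φ z = 0 := fun z hz => by
    rw [twoDbar, fderiv_of_notMem_tsupport ℝ hz]; simp
  have hid : Integrable (twoDbar φ) :=
    (continuous_twoDbar hφ).integrable_of_hasCompactSupport (hasCompactSupport_twoDbar hc)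
  have hiφ : Integrable φ := hφ.continuous.integrable_of_hasCompactSupport hc
  have hil : Integrable fun z => deriv Θ z / Θ z * φ z :=
    integrable_mul (Differentiable.locallyIntegrable_deriv_div hΘ hx) hφ.continuous hc
  have hlim : Tendsto (fun n => ∫ z, F n z) atTop
      (𝓝 (∫ z, (g z / Θ z * a z * -twoDbar φ z + g z / Θ z * b z * φ z))) := by
    refine tendsto_integral_of_dominated_convergence
      (fun z => Ca * ‖twoDbar φ z‖ + Cb * ‖φ z‖ + M * Ca * ‖deriv Θ z / Θ z * φ z‖) ?_ ?_ ?_ ?_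
    · intro n
      have h1 := continuous_twoDbar ((hGs n).mul hφ)
      have h2 := (hGs n).continuous
      have h3 := hφ.continuous
      exact Continuous.aestronglyMeasurable (by simp only [hF]; fun_prop)
    · exact ((hid.norm.const_mul Ca).add (hiφ.norm.const_mul Cb)).add (hil.norm.const_mul _)
    · intro n
      filter_upwards [hae] with z hz
      rw [hFe n z hz]
      refine (norm_sub_le _ _).trans (add_le_add ?_ ?_)
      · rw [norm_mul]
        refine (mul_le_of_le_one_left (norm_nonneg _) (norm_mul_smoothInv_le _)).trans ?_
        refine (norm_add_le _ _).trans (add_le_add ?_ (hbb z))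
        simpa using hba _ hdφ0 z
      · rw [norm_mul, norm_mul, norm_div, RCLike.norm_conj, norm_mul (deriv Θ z / Θ z), norm_div]
        calc _ ≤ M * (‖deriv Θ z‖ / ‖Θ z‖) * (Ca * ‖φ z‖) := by
              gcongr
              · exact mul_nonneg ((norm_nonneg _).trans (hM 0)) (by positivity)
              · exact hM _
              · exact hba φ hφ0 z
          _ = _ := by ring
    · filter_upwards [hae] with z hz
      -- At a fixed z with Θ z ≠ 0 the sequence becomes constant once n|Θ z| > 2.
      refine tendsto_nhds_of_eventually_eq ?_
      have : Tendsto (fun n : ℕ => (n : ℝ) * ‖Θ z‖) atTop atTop :=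
        tendsto_natCast_atTop_atTop.atTop_mul_const (norm_pos_iff.2 hz)
      filter_upwards [this.eventually_gt_atTop 2] with n hn
      have hn' : 2 < ‖(n : ℂ) * Θ z‖ := by simpa using hn
      have h0 : (n : ℂ) * Θ z ≠ 0 := norm_pos_iff.1 (two_pos.trans hn')
      rw [hFe n z hz, twoDbar_smoothInv hn', smoothInv_eq hn'.le, mul_inv_cancel₀ h0]
      ring
  simp only [hF0] at hlim
  exact tendsto_nhds_unique hlim tendsto_const_nhds

lemma weakKer_congr {U : ℂ → ℂ} {α : ℂ} {u v : ℂ → C2} (h : u =ᵐ[volume] v)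
    (hu : WeakKer U α u) : WeakKer U α v := by
  intro φ hφ hc
  obtain ⟨h1, h2⟩ := hu φ hφ hc
  constructor
  · rw [← h1]
    refine integral_congr_ae ?_
    filter_upwards [h] with z hz
    rw [hz]
  · rw [← h2]
    refine integral_congr_ae ?_
    filter_upwards [h] with z hz
    rw [hz]

/-- Each row of the system has the form 2D_{z̄} a + b = 0, with b a continuous multiple of the other
component; `weak_dbar_div` applies row by row. -/
lemma WeakKer.div_smul {U : ℂ → ℂ} (hU : Continuous U) {α : ℂ} {v : ℂ → C2} (hv : Continuous v)
    (hk : WeakKer U α v) {Θ g : ℂ → ℂ} (hΘ : Differentiable ℂ Θ) (hg : Differentiable ℂ g) {x : ℂ}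
    (hx : Θ x ≠ 0) (hb : ∀ z₀, ∃ C, ∀ᶠ z in 𝓝 z₀, ‖(g z / Θ z) • v z‖ ≤ C) :
    WeakKer U α fun z => (g z / Θ z) • v z := by
  have hvi : ∀ i, Continuous fun z => v z i := fun i =>
    (EuclideanSpace.proj (𝕜 := ℂ) i).continuous.comp hv
  have hbi : ∀ i, ∀ z₀, ∃ C, ∀ᶠ z in 𝓝 z₀, ‖g z / Θ z * v z i‖ ≤ C := by
    intro i z₀
    obtain ⟨C, hC⟩ := hb z₀
    refine ⟨C, hC.mono fun z hz => le_trans ?_ hz⟩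
    simpa using PiLp.norm_apply_le ((g z / Θ z) • v z) i
  have hbm : ∀ (W : ℂ → ℂ), Continuous W → ∀ i, ∀ z₀, ∃ C, ∀ᶠ z in 𝓝 z₀,
      ‖g z / Θ z * (α * W z * v z i)‖ ≤ C := by
    intro W hW i z₀
    obtain ⟨C, hC⟩ := hbi i z₀
    have hc : Continuous fun z => ‖α * W z‖ := by fun_prop
    refine ⟨(‖α * W z₀‖ + 1) * C, ?_⟩
    filter_upwards [hC, hc.continuousAt.eventually_le_const (lt_add_one _)] with z h1 h2
    rw [show g z / Θ z * (α * W z * v z i) = (α * W z) * (g z / Θ z * v z i) by ring, norm_mul]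
    exact mul_le_mul h2 h1 (norm_nonneg _) (by positivity)
  have hU' : Continuous fun z => U (-z) := by fun_prop
  have h0 := hvi 0
  have h1 := hvi 1
  intro φ hφ hc
  constructor
  · rw [← weak_dbar_div h0 (b := fun z => α * U z * v z 1) (by fun_prop) hΘ hg hx (hbi 0)
      (hbm U hU 1) (fun φ hφ hc => (hk φ hφ hc).1) hφ hc]
    refine integral_congr_ae (.of_forall fun z => ?_)
    simp only [PiLp.smul_apply, smul_eq_mul]; ring
  · rw [← weak_dbar_div h1 (b := fun z => α * U (-z) * v z 0) (by fun_prop) hΘ hg hx (hbi 1)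
      (hbm _ hU' 0) (fun φ hφ hc => by
        rw [← (hk φ hφ hc).2]
        exact integral_congr_ae (.of_forall fun z => add_comm _ _)) hφ hc]
    refine integral_congr_ae (.of_forall fun z => ?_)
    simp only [PiLp.smul_apply, smul_eq_mul]; ring

/-! ### Order of vanishing; the lattice and its cell. -/

/-- Induction on m through the derivative and the mean value inequality on the ball of radius |z -
z₀|. E and F share a universe because the induction replaces F by E →L[ℝ] F. -/
lemma norm_le_pow_of_iteratedFDeriv_eq_zero.{w} {E F : Type w} [NormedAddCommGroup E]
    [NormedSpace ℝ E] [NormedAddCommGroup F] [NormedSpace ℝ F] {v : E → F} (hv : ContDiff ℝ ∞ v)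
    {z₀ : E} {m : ℕ} (h : ∀ j < m, iteratedFDeriv ℝ j v z₀ = 0) :
    ∃ C, 0 ≤ C ∧ ∀ᶠ z in 𝓝 z₀, ‖v z‖ ≤ C * ‖z - z₀‖ ^ m := by
  induction m generalizing F with
  | zero =>
    refine ⟨‖v z₀‖ + 1, by positivity, ?_⟩
    filter_upwards [hv.continuous.norm.continuousAt.eventually_le_const (lt_add_one _)] with z hz
    simpa using hz
  | succ m ih =>
    have hd : ContDiff ℝ ∞ (fderiv ℝ v) := hv.fderiv_right (by simp)
    obtain ⟨C, hC0, hC⟩ := ih hd fun j hj => by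
      rw [← norm_eq_zero, norm_iteratedFDeriv_fderiv, h (j + 1) (by omega), norm_zero]
    refine ⟨C, hC0, ?_⟩
    have h0 : v z₀ = 0 := by
      have := h 0 m.succ_pos
      rw [← norm_eq_zero, norm_iteratedFDeriv_zero] at this
      exact norm_eq_zero.1 this
    obtain ⟨r, hr, hb⟩ := Metric.nhds_basis_ball.eventually_iff.1 hC
    filter_upwards [Metric.ball_mem_nhds z₀ hr] with z hz
    have key := (convex_closedBall z₀ ‖z - z₀‖).norm_image_sub_le_of_norm_fderiv_le (𝕜 := ℝ)
      (f := v) (C := C * ‖z - z₀‖ ^ m) (x := z₀) (y := z)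
      (fun x _ => hv.differentiable (by simp) x) (fun x hx => ?_)
      (Metric.mem_closedBall_self (norm_nonneg _)) (by simp [dist_eq_norm])
    · rwa [h0, sub_zero, mul_assoc, ← pow_succ] at key
    · rw [Metric.mem_closedBall, dist_eq_norm] at hx
      rw [Metric.mem_ball, dist_eq_norm] at hz
      refine (hb (by rw [Metric.mem_ball, dist_eq_norm]; exact hx.trans_lt hz)).trans ?_
      gcongr

lemma rot_im_pos : 0 < rot.im := by
  have : rot = Complex.exp ((2 * Real.pi / 3 : ℝ) * Complex.I) := by
    rw [rot]; congr 1; push_cast; ring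
  rw [this, Complex.exp_ofReal_mul_I_im]
  have := Real.pi_pos
  exact Real.sin_pos_of_pos_of_lt_pi (by positivity) (by linarith)

lemma eq_and_eq_of_mul_rot_add {a b c d : ℝ} (h : (a : ℂ) * rot + b = c * rot + d) :
    a = c ∧ b = d := by
  have h1 := congrArg Complex.im h
  simp only [Complex.add_im, Complex.im_ofReal_mul, Complex.ofReal_im, add_zero] at h1
  have h1 := mul_right_cancel₀ rot_im_pos.ne' h1
  refine ⟨h1, ?_⟩
  rw [h1] at h
  exact_mod_cast add_left_cancel h

lemma eq_of_sub_mem_lattice {a b : ℂ} (ha : a ∈ cell) (hb : b ∈ cell) (h : a - b ∈ lattice) :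
    a = b := by
  obtain ⟨s, hs, t, ht, rfl⟩ := ha
  obtain ⟨s', hs', t', ht', rfl⟩ := hb
  obtain ⟨m, n, h⟩ := h
  obtain ⟨h1, h2⟩ := eq_and_eq_of_mul_rot_add (a := s - s') (b := t - t') (c := m) (d := n)
    (by push_cast; linear_combination h)
  have aux : ∀ {x y : ℝ} {n : ℤ}, x ∈ Set.Ico (0 : ℝ) 1 → y ∈ Set.Ico (0 : ℝ) 1 →
      x - y = n → x = y := by
    rintro x y n ⟨hx0, hx1⟩ ⟨hy0, hy1⟩ h
    have h1 : (-1 : ℝ) < n := by linarith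
    have h2 : (n : ℝ) < 1 := by linarith
    have h1 : -1 < n := by exact_mod_cast h1
    have h2 : n < 1 := by exact_mod_cast h2
    obtain rfl : n = 0 := by omega
    rw [Int.cast_zero] at h
    linarith
  rw [aux hs hs' h1, aux ht ht' h2]

lemma exists_add_mem_cell (z : ℂ) : ∃ γ ∈ lattice, z + γ ∈ cell := by
  set s := z.im / rot.im
  set t := z.re - s * rot.re
  have hz : z = s * rot + t := by
    apply Complex.ext
    · simp [t]
    · simp [s, div_mul_cancel₀ _ rot_im_pos.ne']
  refine ⟨(-⌊s⌋ : ℤ) * rot + (-⌊t⌋ : ℤ), ⟨_, _, rfl⟩, Int.fract s,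
    ⟨Int.fract_nonneg _, Int.fract_lt_one _⟩, Int.fract t,
    ⟨Int.fract_nonneg _, Int.fract_lt_one _⟩, ?_⟩
  conv_lhs => rw [hz]
  simp only [Int.fract]
  push_cast
  ring

lemma apply_add_lattice {f : ℂ → ℂ} (h1 : ∀ z, f (z + 1) = f z) (hr : ∀ z, f (z + rot) = f z)
    {γ : ℂ} (hγ : γ ∈ lattice) (z : ℂ) : f (z + γ) = f z := by
  obtain ⟨m, n, rfl⟩ := hγ
  have h2 : Function.Periodic f (n * 1) := Function.Periodic.int_mul h1 n
  have h3 : Function.Periodic f (m * rot) := Function.Periodic.int_mul hr m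
  rw [mul_one] at h2
  rw [← add_assoc, h2, h3]

/-! ### From the zero count to a divisor. -/

/-- A finite supremum of a nonempty family in `ℕ∞` is attained; n > 0 excludes the empty family,
whose supremum is 0. -/
lemma exists_rep_of_zeroOrder_eq {u : ℂ →ₘ[volume] C2} {z : ℂ} {n : ℕ} (hn : 0 < n)
    (h : zeroOrder u z = n) : ∃ v : ℂ → C2, ContDiff ℝ ∞ v ∧ u =ᵐ[volume] v ∧
      ∀ j < n, iteratedFDeriv ℝ j v z = 0 := by
  rw [zeroOrder, iSup_subtype'] at h
  rcases isEmpty_or_nonempty {m : ℕ // ∃ v : ℂ → C2, ContDiff ℝ ∞ v ∧ u =ᵐ[volume] v ∧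
    ∀ j < m, iteratedFDeriv ℝ j v z = 0} with he | he
  · rw [iSup_of_empty] at h
    exact absurd h (by simpa using (Nat.cast_ne_zero.2 hn.ne').symm)
  · obtain ⟨⟨m, hm⟩, e⟩ := ENat.exists_eq_iSup_of_lt_top (h.trans_lt (ENat.natCast_lt_top n))
    rw [h] at e
    obtain rfl : m = n := by exact_mod_cast e
    exact hm

/-- A nonzero finite zero count yields a smooth representative and a divisor of zeros. -/
lemma exists_divisor_of_zeroCount_eq {u : ℂ →ₘ[volume] C2} {k : ℕ} (hk0 : 0 < k)
    (hk : zeroCount u = k) : ∃ v : ℂ → C2, ContDiff ℝ ∞ v ∧ u =ᵐ[volume] v ∧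
      ∃ (s : Finset cell) (m : cell → ℕ), ∑ a ∈ s, m a = k ∧
        ∀ a ∈ s, ∀ j < m a, iteratedFDeriv ℝ j v a = 0 := by
  obtain ⟨s, hs⟩ := ENat.exists_eq_iSup_of_lt_top (hk.trans_lt (ENat.natCast_lt_top k))
  rw [zeroCount] at hk
  rw [hk] at hs
  have hfin : ∀ a ∈ s, zeroOrder u a = (zeroOrder u a).toNat := fun a ha => by
    refine (ENat.natCast_toNat fun htop => ?_).symm
    have := Finset.single_le_sum (f := fun a : cell => zeroOrder u a) (fun _ _ => bot_le) ha
    rw [hs, htop] at this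
    exact absurd this (by simp)
  have hsum : ∑ a ∈ s, (zeroOrder u a).toNat = k := by
    rw [Finset.sum_congr rfl hfin] at hs
    exact_mod_cast hs
  -- Positivity of k yields a point of positive order, which supplies the smooth representative.
  obtain ⟨a, ha, ha0⟩ : ∃ a ∈ s, (zeroOrder u a).toNat ≠ 0 :=
    Finset.exists_ne_zero_of_sum_ne_zero (hsum.trans_ne hk0.ne')
  obtain ⟨v, hv, huv, -⟩ := exists_rep_of_zeroOrder_eq (Nat.pos_of_ne_zero ha0) (hfin a ha)
  refine ⟨v, hv, huv, s, fun a => (zeroOrder u a).toNat, hsum, fun b hb j hj => ?_⟩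
  obtain ⟨w, hw, huw, h⟩ := exists_rep_of_zeroOrder_eq (j.zero_le.trans_lt hj) (hfin b hb)
  -- Representatives obtained at different zeros agree, being continuous and equal almost
  -- everywhere.
  have : v = w := (hv.continuous.ae_eq_iff_eq volume hw.continuous).1 (huv.symm.trans huw)
  rw [this]
  exact h j hj

/-! ### Twisted periodicity and quotients by the theta divisor. -/

lemma norm_phase (z w : ℂ) : ‖phase z w‖ = 1 := by
  rw [phase, mul_comm, Complex.norm_exp_ofReal_mul_I]

lemma twistedTranslate_smul (K γ : ℂ) {f : ℂ → ℂ} (hf : ∀ z, f (z + γ) = f z) (v : ℂ → C2)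
    (z : ℂ) : twistedTranslate K γ (fun z => f z • v z) z = f z • twistedTranslate K γ v z := by
  ext i
  fin_cases i <;> simp [twistedTranslate, hf, mul_left_comm]

/-- The phases are unitary, so |v| is Λ-periodic and local bounds need checking only on the cell. -/
lemma norm_add_eq_of_twistedTranslate {K p γ z : ℂ} {v : ℂ → C2}
    (h : twistedTranslate K γ v z = phase p γ • v z) : ‖v (z + γ)‖ = ‖v z‖ := by
  have h1 : ‖twistedTranslate K γ v z‖ = ‖v (z + γ)‖ := by
    simp [twistedTranslate, EuclideanSpace.norm_eq, norm_phase]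
  rw [← h1, h, norm_smul, norm_phase, one_mul]

lemma twistedTranslate_of_ae {K p γ : ℂ} {u v : ℂ → C2} (huv : u =ᵐ[volume] v)
    (hv : Continuous v) (h : ∀ᵐ z, twistedTranslate K γ u z = phase p γ • u z) (z : ℂ) :
    twistedTranslate K γ v z = phase p γ • v z := by
  have hc : Continuous (twistedTranslate K γ v) := by
    have h1 : ∀ i, Continuous fun z => v (z + γ) i := fun i =>
      (EuclideanSpace.proj (𝕜 := ℂ) i).continuous.comp (hv.comp (continuous_add_const γ))
    have h2 := h1 0
    have h3 := h1 1
    refine (PiLp.continuous_toLp 2 _).comp (continuous_pi fun i => ?_)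
    fin_cases i <;> simp <;> fun_prop
  refine congrFun ((hc.ae_eq_iff_eq volume (hv.const_smul (phase p γ))).1 ?_) z
  have h1 := (measurePreserving_add_right volume γ).quasiMeasurePreserving.ae huv
  filter_upwards [h, huv, h1] with z e1 e2 e3
  rw [Pi.smul_apply, ← e2, ← e1, twistedTranslate, twistedTranslate, e3]

/-- The theta function vanishing to order `m a` at the points `a ∈ s`. -/
def thetaDivisor (s : Finset cell) (m : cell → ℕ) (z : ℂ) : ℂ :=
  ∏ a ∈ s, theta rot (z - a) ^ m a

lemma differentiable_thetaDivisor (s : Finset cell) (m : cell → ℕ) :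
    Differentiable ℂ (thetaDivisor s m) := by
  have h := differentiable_theta rot_im_pos
  unfold thetaDivisor
  fun_prop

lemma thetaDivisor_add_one (s : Finset cell) (m : cell → ℕ) (z : ℂ) :
    thetaDivisor s m (z + 1) = thetaDivisor s m z := by
  simp only [thetaDivisor, add_sub_right_comm, theta_add_one]

/-- Each factor contributes -e^{2πia}e^{-2πiz}. The positions of the zeros enter only through a
constant, which the parameter c of `thetaBasis` can match. -/
lemma thetaDivisor_add_rot (s : Finset cell) (m : cell → ℕ) (z : ℂ) :
    thetaDivisor s m (z + rot) =
      (∏ a ∈ s, (-exp2pi a) ^ m a) * exp2pi (-z) ^ (∑ a ∈ s, m a) * thetaDivisor s m z := by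
  rw [← Finset.prod_pow_eq_pow_sum, ← Finset.prod_mul_distrib, thetaDivisor, thetaDivisor,
    ← Finset.prod_mul_distrib]
  refine Finset.prod_congr rfl fun a _ => ?_
  rw [← mul_pow, ← mul_pow, add_sub_right_comm, theta_add_period rot_im_pos, neg_sub,
    sub_eq_add_neg, exp2pi_add]
  congr 1
  ring

lemma theta_rot_sub_ne_zero {a b : cell} (h : a ≠ b) : theta rot ((a : ℂ) - b) ≠ 0 := by
  rw [Ne, theta_eq_zero_iff rot_im_pos]
  exact fun h' => h (Subtype.ext (eq_of_sub_mem_lattice a.2 b.2 h'))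

lemma thetaDivisor_ne_zero {s : Finset cell} (m : cell → ℕ) {a : cell} (ha : a ∉ s) :
    thetaDivisor s m a ≠ 0 :=
  Finset.prod_ne_zero_iff.2 fun _ hb =>
    pow_ne_zero _ (theta_rot_sub_ne_zero fun h => ha (h ▸ hb))

lemma exists_thetaDivisor_ne_zero (s : Finset cell) (m : cell → ℕ) :
    ∃ z, thetaDivisor s m z ≠ 0 := by
  have : Infinite cell := by
    -- The offset 2 keeps 1/(n + 2) below 1 already at n = 0.
    refine Infinite.of_injective (fun n : ℕ => (⟨((1 / (n + 2 : ℝ) : ℝ) : ℂ), 0, by simp,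
      1 / (n + 2 : ℝ), ⟨by positivity, ?_⟩, by simp⟩ : cell)) fun a b h => ?_
    · rw [div_lt_one (by positivity)]
      have : (0 : ℝ) ≤ n := n.cast_nonneg
      linarith
    · have h1 := Complex.ofReal_injective (Subtype.ext_iff.1 h)
      have h2 := inv_injective (by simpa only [one_div] using h1)
      exact_mod_cast add_right_cancel h2
  obtain ⟨a, ha⟩ := Infinite.exists_notMem_finset s
  exact ⟨a, thetaDivisor_ne_zero m ha⟩

/-- Near a zero a, v is O(|z - a|^(m a)), while Θ is θ(z - a)^(m a), at least of that size, times a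
factor nonvanishing at a. -/
lemma div_thetaDivisor_smul_bound {s : Finset cell} {m : cell → ℕ} {g : ℂ → ℂ} (hg : Continuous g)
    {v : ℂ → C2} (hv : ContDiff ℝ ∞ v) (h : ∀ a ∈ s, ∀ j < m a, iteratedFDeriv ℝ j v a = 0)
    (a : cell) : ∃ C, ∀ᶠ z in 𝓝 (a : ℂ), ‖(g z / thetaDivisor s m z) • v z‖ ≤ C := by
  classical
  by_cases ha : a ∈ s
  · have hr : thetaDivisor (s.erase a) m a ≠ 0 := thetaDivisor_ne_zero m (s.notMem_erase a)
    have hrc := (differentiable_thetaDivisor (s.erase a) m).continuous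
    have hq : ContinuousAt (fun z => ‖g z / thetaDivisor (s.erase a) m z‖) a :=
      (hg.continuousAt.div hrc.continuousAt hr).norm
    obtain ⟨C, hC0, hC⟩ := norm_le_pow_of_iteratedFDeriv_eq_zero hv (h a ha)
    obtain ⟨c, hc0, hc⟩ := theta_lower_bound rot_im_pos
    have ht : Tendsto (fun z => z - (a : ℂ)) (𝓝 a) (𝓝 0) := by
      have : Continuous fun z => z - (a : ℂ) := by fun_prop
      simpa using this.tendsto (a : ℂ)
    refine ⟨(‖g a / thetaDivisor (s.erase a) m a‖ + 1) * (C * c⁻¹ ^ m a), ?_⟩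
    filter_upwards [hq.eventually_le_const (lt_add_one _), hC, ht.eventually hc] with z h1 h2 h3
    set t := ‖theta rot (z - a)‖ ^ m a with htdef
    have h4 : ‖v z‖ ≤ C * c⁻¹ ^ m a * t := by
      refine h2.trans ?_
      rw [mul_assoc, ← mul_pow]
      gcongr
      rwa [← div_eq_inv_mul, le_div_iff₀' hc0]
    have h5 : thetaDivisor s m z = theta rot (z - a) ^ m a * thetaDivisor (s.erase a) m z :=
      (Finset.mul_prod_erase s (fun a : cell => theta rot (z - a) ^ m a) ha).symm
    calc ‖(g z / thetaDivisor s m z) • v z‖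
        = ‖g z / thetaDivisor (s.erase a) m z‖ * (‖v z‖ / t) := by
          rw [norm_smul, h5, norm_div, norm_mul, norm_pow, norm_div, ← htdef, div_mul_div_comm,
            div_mul_eq_mul_div, mul_comm t]
      _ ≤ (‖g a / thetaDivisor (s.erase a) m a‖ + 1) * (C * c⁻¹ ^ m a) := by
          refine mul_le_mul h1 ?_ (by positivity) (by positivity)
          -- This covers t = 0 too, where the quotient is 0 by convention.
          exact div_le_of_le_mul₀ (by positivity) (by positivity) h4
  · have hc : ContinuousAt (fun z => ‖(g z / thetaDivisor s m z) • v z‖) a :=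
      ((hg.continuousAt.div (differentiable_thetaDivisor s m).continuous.continuousAt
        (thetaDivisor_ne_zero m ha)).smul hv.continuous.continuousAt).norm
    exact ⟨_, hc.eventually_le_const (lt_add_one _)⟩

/-! ### Membership in the kernel, independence, and the dimension bound. -/

lemma LocL2.of_locally_bounded {w : ℂ → C2} (hw : AEStronglyMeasurable w volume)
    (hb : ∀ z₀, ∃ C, ∀ᶠ z in 𝓝 z₀, ‖w z‖ ≤ C) : LocL2 w := by
  intro S hS
  have : IsFiniteMeasure (volume.restrict S) := ⟨by simpa using hS.measure_lt_top⟩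
  obtain ⟨C, hC⟩ := exists_bound_on_compact (f := fun z => (‖w z‖ : ℂ)) (by simpa using hb) hS
  refine MemLp.of_bound hw.restrict C ?_
  filter_upwards [ae_restrict_mem hS.measurableSet] with z hz
  simpa using hC z hz

lemma locL2_congr {u v : ℂ → C2} (h : u =ᵐ[volume] v) (hv : LocL2 v) : LocL2 u :=
  fun S hS => (hv S hS).ae_eq (ae_restrict_of_ae h.symm)

lemma mk_mem_kerD {K : ℂ} {U : C(ℂ, ℂ)} {α p : ℂ} {w : ℂ → C2}
    (hw : AEStronglyMeasurable w volume) (h2 : LocL2 w) (hk : WeakKer U α w)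
    (ht : ∀ γ ∈ lattice, ∀ z, twistedTranslate K γ w z = phase p γ • w z) :
    AEEqFun.mk w hw ∈ kerD K U α p := by
  have he := AEEqFun.coeFn_mk w hw
  refine ⟨⟨locL2_congr he h2, fun γ hγ => ?_⟩, weakKer_congr he.symm hk⟩
  have h1 := (measurePreserving_add_right volume γ).quasiMeasurePreserving.ae he
  filter_upwards [he, h1] with z e1 e2
  rw [e1, ← ht γ hγ, twistedTranslate, twistedTranslate, e2]

/-- A linear relation, multiplied by Θ, reads G v = 0 almost everywhere, hence everywhere by
continuity. Then G vanishes near y, so identically. -/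
lemma linearIndependent_mk_smul {ι : Type*} [Finite ι] {g : ι → ℂ → ℂ}
    (hg : LinearIndependent ℂ g)
    (hgd : ∀ i, Differentiable ℂ (g i)) {Θ : ℂ → ℂ} (hΘ : Differentiable ℂ Θ) {x : ℂ}
    (hx : Θ x ≠ 0) {v : ℂ → C2} (hv : Continuous v) {y : ℂ} (hy : v y ≠ 0)
    (hm : ∀ i, AEStronglyMeasurable (fun z => (g i z / Θ z) • v z) volume) :
    LinearIndependent ℂ fun i => AEEqFun.mk _ (hm i) := by
  have := Fintype.ofFinite ι
  rw [Fintype.linearIndependent_iff] at hg ⊢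
  intro c hc
  refine hg c ?_
  set G : ℂ → ℂ := ∑ i, c i • g i with hG
  have hGd : Differentiable ℂ G := by
    rw [hG]
    exact Differentiable.sum fun i _ => (hgd i).const_smul (c i)
  have h1 : (fun z => G z • v z) =ᵐ[volume] fun _ => 0 := by
    have e1 : ∀ s : Finset ι, (∑ i ∈ s, c i • AEEqFun.mk _ (hm i) : ℂ →ₘ[volume] C2)
        =ᵐ[volume] fun z => ∑ i ∈ s, c i • (g i z / Θ z) • v z := by
      classical
      intro s
      induction s using Finset.induction_on with
      | empty => exact AEEqFun.coeFn_zero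
      | insert i s hi ih =>
        rw [Finset.sum_insert hi]
        filter_upwards [AEEqFun.coeFn_add (c i • AEEqFun.mk _ (hm i))
          (∑ i ∈ s, c i • AEEqFun.mk _ (hm i)), ih, AEEqFun.coeFn_smul (c i) (AEEqFun.mk _ (hm i)),
          AEEqFun.coeFn_mk _ (hm i)] with z a1 a2 a3 a4
        rw [a1, Pi.add_apply, a2, a3, Pi.smul_apply, a4, Finset.sum_insert hi]
    have e2 := e1 Finset.univ
    rw [hc] at e2
    filter_upwards [e2, AEEqFun.coeFn_zero (α := ℂ) (β := C2) (μ := (volume : Measure ℂ)),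
      Differentiable.ae_ne_zero hΘ hx] with z a1 a2 a3
    rw [a2, Pi.zero_apply] at a1
    have : G z • v z = Θ z • ∑ i, c i • (g i z / Θ z) • v z := by
      simp only [hG, Finset.sum_apply, Pi.smul_apply, smul_smul, ← Finset.sum_smul, smul_eq_mul,
        Finset.mul_sum]
      congr 1
      refine Finset.sum_congr rfl fun i _ => ?_
      field_simp
    rw [this, ← a1, smul_zero]
  have h2 := (hGd.continuous.smul hv).ae_eq_iff_eq volume continuous_const |>.1 h1
  have h3 : ∀ᶠ z in 𝓝 y, G z = 0 := by
    filter_upwards [hv.continuousAt.eventually_ne hy] with z hz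
    exact (smul_eq_zero.1 (congrFun h2 z)).resolve_right hz
  funext z
  exact AnalyticOnNhd.eqOn_zero_of_preconnected_of_eventuallyEq_zero
      (fun z _ => hGd.analyticAt z : AnalyticOnNhd ℂ G Set.univ) isPreconnected_univ
      (Set.mem_univ y) h3 (Set.mem_univ z)

theorem natCast_le_rank_kerD {K : ℂ} {U : C(ℂ, ℂ)} {α p : ℂ} {u : ℂ →ₘ[volume] C2}
    (hu : u ∈ kerD K U α p) (hu0 : u ≠ 0) {k : ℕ} (hk : zeroCount u = k) :
    (k : Cardinal) ≤ Module.rank ℂ (kerD K U α p) := by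
  rcases k.eq_zero_or_pos with rfl | hk0
  · simp
  obtain ⟨v, hv, huv, s, m, hsum, hzero⟩ := exists_divisor_of_zeroCount_eq hk0 hk
  have hvc := hv.continuous
  obtain ⟨⟨-, hut⟩, huk⟩ := hu
  have hvt : ∀ γ ∈ lattice, ∀ z, twistedTranslate K γ v z = phase p γ • v z :=
    fun γ hγ => twistedTranslate_of_ae huv hvc (hut γ hγ)
  obtain ⟨y, hy⟩ : ∃ y, v y ≠ 0 := by
    by_contra! h0
    refine hu0 (AEEqFun.ext (huv.trans ?_))
    rw [show v = 0 from funext h0]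
    exact AEEqFun.coeFn_zero.symm
  obtain ⟨x, hx⟩ := exists_thetaDivisor_ne_zero s m
  have hΘ := differentiable_thetaDivisor s m
  have hprod : ∏ a ∈ s, (-exp2pi a) ^ m a ≠ 0 :=
    Finset.prod_ne_zero_iff.2 fun a _ => pow_ne_zero _ (neg_ne_zero.2 (exp2pi_ne_zero _))
  -- With parameter -c the basis has multiplier -e^{2πic}e^{-2πikz} under the period ω; this c makes
  -- it the multiplier of Θ.
  obtain ⟨c, hc⟩ := exists_exp2pi_eq (neg_ne_zero.2 hprod)
  set g : Fin k → ℂ → ℂ := fun j => thetaBasis rot (-c) k j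
  have hg : ∀ j, Differentiable ℂ (g j) := fun j =>
    differentiable_thetaBasis rot_im_pos (-c) hk0 j
  have hper : ∀ j, ∀ γ ∈ lattice, ∀ z,
      g j (z + γ) / thetaDivisor s m (z + γ) = g j z / thetaDivisor s m z := by
    intro j γ hγ
    refine apply_add_lattice (f := fun z => g j z / thetaDivisor s m z) (fun z => ?_)
      (fun z => ?_) hγ
    · simp only [g, thetaBasis_add_one, thetaDivisor_add_one]
    · simp only [g, thetaBasis_add_period rot_im_pos (-c) hk0, thetaDivisor_add_rot, hsum]
      rw [show -((k : ℂ) * z + -c) = k * -z + c by ring, exp2pi_add, exp2pi_natCast_mul, hc,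
        mul_neg, neg_neg, mul_comm (exp2pi (-z) ^ k)]
      exact mul_div_mul_left _ _ (mul_ne_zero hprod (pow_ne_zero _ (exp2pi_ne_zero _)))
  have hb : ∀ j z₀, ∃ C, ∀ᶠ z in 𝓝 z₀, ‖(g j z / thetaDivisor s m z) • v z‖ ≤ C := by
    intro j z₀
    -- The bound is available at points of the cell; periodicity of g_j/Θ and of |v| carries it to
    -- z₀.
    obtain ⟨γ, hγ, hcell⟩ := exists_add_mem_cell z₀
    obtain ⟨C, hC⟩ := div_thetaDivisor_smul_bound (hg j).continuous hv hzero ⟨_, hcell⟩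
    refine ⟨C, ?_⟩
    filter_upwards [(continuous_add_const γ).continuousAt.eventually hC] with z hz
    rwa [hper j γ hγ, norm_smul, norm_add_eq_of_twistedTranslate (hvt γ hγ z), ← norm_smul] at hz
  have hmeas : ∀ j, AEStronglyMeasurable (fun z => (g j z / thetaDivisor s m z) • v z) volume :=
    fun j => (((hg j).continuous.measurable.div hΘ.continuous.measurable).smul
      hvc.measurable).aestronglyMeasurable
  have hmem : ∀ j, AEEqFun.mk _ (hmeas j) ∈ kerD K U α p := fun j =>
    mk_mem_kerD (hmeas j) (LocL2.of_locally_bounded (hmeas j) (hb j))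
      (WeakKer.div_smul U.continuous hvc (weakKer_congr huv huk) hΘ (hg j) hx (hb j))
      fun γ hγ z => by
        rw [twistedTranslate_smul K γ (hper j γ hγ), hvt γ hγ, smul_comm]
  have hli := linearIndependent_mk_smul (linearIndependent_thetaBasis rot_im_pos (-c) hk0) hg hΘ hx
    hvc hy hmeas
  have hli' : LinearIndependent ℂ fun j => (⟨_, hmem j⟩ : kerD K U α p) :=
    LinearIndependent.of_comp (kerD K U α p).subtype hli
  simpa using hli'.cardinal_le_rank

end

end TBG

theorem lemma4p1 (K : ℂ) (hK : TBG.IsDiracPoint K)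
    (U : C(ℂ, ℂ)) (hU : TBG.IsPotential K U) (α p : ℂ)
    (u : ℂ →ₘ[MeasureTheory.volume] TBG.C2) (hu : u ∈ TBG.kerD K U α p) (hu0 : u ≠ 0)
    (k : ℕ) (hk : TBG.zeroCount u = k) :
    (k : Cardinal) ≤ Module.rank ℂ (TBG.kerD K U α p) :=
  TBG.natCast_le_rank_kerD hu hu0 hk
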